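/- Let $Q_n$ be the $n$-dimensional hypercube graph (vertices $\{0,1\}^n$, two vertices adjacent when they differ in exactly one coordinate) and let $C_{2k}$ be the cycle on $2k$ vertices. For a finite graph $G$ and graphs $T,H$, a copy of $T$ in $G$ is a (not necessarily induced) subgraph of $G$ isomorphic to $T$; let $N(G,T)$ be the number of copies of $T$ in $G$, let $\mathrm{ex}(G,T,H)$ be the maximum of $N(G',T)$ over all subgraphs $G'\subseteq G$ that contain no copy of $H$, and let $\mathbf{d}(G,T,H)=\mathrm{ex}(G,T,H)/N(G,T)$ (read as $0$ if $N(G,T)=0$). (a) For all integers $k\ge 2$ and $\ell,n\ge 0$ with $\ell\ge\log_2(2k)$, we have $\mathbf{d}(Q_n,Q_\ell,C_{2k})=0$. (b) For every integer $k\ge 4$ with $k\ne 5$ there is a constant $c_k>0$, depending only on $k$, such that for all integers $\ell,n$ with $2\le\ell<\log_2(2k)\le n$, and with $m=\lceil\log_2(2k)\rceil-1$, $$\binom{m}{\ell}\binom{n}{\ell}^{-1}\le \mathbf{d}(Q_n,Q_\ell,C_{2k})\le c_k\,n^{-1/16}.$$ -/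

import Mathlib

/-- The hypercube of dimension `n`: vertices are binary sequences of length `n`, and two of them
are adjacent when they differ in exactly one position. -/
def hypercube (n : ℕ) : SimpleGraph (Fin n → Bool) where
  Adj u v := hammingDist u v = 1
  symm := ⟨fun u v h => by rwa [hammingDist_comm]⟩
  loopless := ⟨fun u h => by simp at h⟩

open Classical in
/-- The generalized extremal number `ex(G, T, H)`: the largest number of copies of `T` (subgraphs
isomorphic to `T`) in an `H`-free subgraph `G'` of the finite graph `G`. -/
noncomputable def genExtremalNumber {V W U : Type*} [Fintype V]
    (G : SimpleGraph V) (T : SimpleGraph W) (H : SimpleGraph U) : ℕ :=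
  (Finset.univ.filter fun G' : G.Subgraph => H.Free G'.coe).sup fun G' => G'.coe.copyCount T

/-- The generalized Turán density `d(G, T, H) = ex(G, T, H) / N(G, T)`, where `N(G, T)` is the
number of copies of `T` in `G`. -/
noncomputable def genTuranDensity {V W U : Type*} [Fintype V]
    (G : SimpleGraph V) (T : SimpleGraph W) (H : SimpleGraph U) : ℝ :=
  (genExtremalNumber G T H : ℝ) / (G.copyCount T : ℝ)

/-!
Every copy of `Q_ℓ` in `Q_n` is a subcube, determined up to relabelling by a vertex `v` and `ℓ`
directions. Copies may be counted with labels, since this multiplies all counts by the number of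
automorphisms of `Q_ℓ`.

If `2k ≤ 2^ℓ`, then `Q_ℓ` contains `C_{2k}`: run along a path of length `k - 1` in one facet and
back along its translate in the opposite facet. Hence a `C_{2k}`-free graph contains no `Q_ℓ`.

For the lower bound keep the edges of `Q_n` in `m` fixed directions. The components have
`2^m < 2k` vertices, too few for `C_{2k}`, and each of them is a copy of `Q_m`.

For the upper bound let `K ≤ Q_n` be `C_{2k}`-free and fix a vertex `v`. Join two directions `i` and
`j` when the square at `v` spanned by them lies in `K`. A path with `k - 1` edges in this graph on
the `n` directions gives a zigzag of length `2k - 2` between the first and second neighbourhoods of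
`v`, which closes through `v` to a `C_{2k}`; so there is no such path, and the graph has only `O(n)`
edges. Of the `n^ℓ` possible choices of `ℓ` directions at `v` only `O(n^(ℓ - 1))` therefore survive,
and the density is `O(1/n)`, which is stronger than `O(n^(-1/16))`.
-/

open SimpleGraph

section GeneralizedTuran

variable {U V W : Type*} {G K : SimpleGraph V} {T : SimpleGraph W} {H : SimpleGraph U}

theorem toSubgraph_comp_isoToCopy (B : G.Subgraph) (e : T ≃g B.coe) :
    (B.coeCopy.comp e.toCopy).toSubgraph = B := by
  have h : (B.coeCopy.comp e.toCopy).toHom = B.hom.comp e.toHom := rfl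
  simp [Copy.toSubgraph, h, Subgraph.map_comp]

theorem isContained_coe_of_isContained_spanningCoe {G' : G.Subgraph} (hH : H.support = Set.univ)
    (h : H ⊑ G'.spanningCoe) : H ⊑ G'.coe := by
  obtain ⟨f⟩ := h
  have hverts (u : U) : f u ∈ G'.verts := by
    obtain ⟨w, hw⟩ := H.mem_support.1 (hH ▸ Set.mem_univ u)
    exact (f.toHom.map_adj hw).fst_mem
  exact ⟨⟨⟨fun u ↦ ⟨f u, hverts u⟩, fun hadj ↦ f.toHom.map_adj hadj⟩,
    fun u w huw ↦ f.injective (congrArg Subtype.val huw)⟩⟩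

/-- A labelled copy is the subgraph it spans together with an isomorphism onto that subgraph. -/
noncomputable def sigmaIsoEquivCopy (T : SimpleGraph W) (G : SimpleGraph V) :
    (Σ B : {B : G.Subgraph // Nonempty (T ≃g B.coe)}, T ≃g B.1.coe) ≃ Copy T G :=
  Equiv.ofBijective (fun x ↦ x.1.1.coeCopy.comp x.2.toCopy) <| by
    refine ⟨?_, fun f ↦ ⟨⟨⟨f.toSubgraph, ⟨f.isoToSubgraph⟩⟩, f.isoToSubgraph⟩, rfl⟩⟩
    rintro ⟨⟨B, hB⟩, e⟩ ⟨⟨B', hB'⟩, e'⟩ h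
    obtain rfl : B = B' := by
      rw [← toSubgraph_comp_isoToCopy B e, ← toSubgraph_comp_isoToCopy B' e']
      exact congrArg Copy.toSubgraph h
    congr 1
    ext a
    exact DFunLike.congr_fun h a

theorem card_iso_self_pos [Finite W] (T : SimpleGraph W) : 0 < Nat.card (T ≃g T) :=
  have : Finite (T ≃g T) := Finite.of_injective _ DFunLike.coe_injective
  have : Nonempty (T ≃g T) := ⟨Iso.refl⟩
  Nat.card_pos

variable [Fintype V]

theorem labelledCopyCount_eq_natCard [Fintype W] (G : SimpleGraph V) (T : SimpleGraph W) :
    G.labelledCopyCount T = Nat.card (Copy T G) := by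
  classical
  exact Nat.card_eq_fintype_card.symm

theorem labelledCopyCount_eq_copyCount_mul [Fintype W] (G : SimpleGraph V) (T : SimpleGraph W) :
    G.labelledCopyCount T = G.copyCount T * Nat.card (T ≃g T) := by
  classical
  let E (B : {B : G.Subgraph // Nonempty (T ≃g B.coe)}) : (T ≃g B.1.coe) ≃ (T ≃g T) :=
    { toFun := fun e ↦ e.trans B.2.some.symm
      invFun := fun e ↦ e.trans B.2.some
      left_inv := fun e ↦ by ext; simp
      right_inv := fun e ↦ by ext; simp }
  rw [labelledCopyCount_eq_natCard, copyCount, ← Nat.card_congr (sigmaIsoEquivCopy T G),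
    Nat.card_congr ((Equiv.sigmaCongrRight E).trans (Equiv.sigmaEquivProd _ _)), Nat.card_prod,
    Nat.card_eq_fintype_card, Fintype.card_subtype]

theorem labelledCopyCount_le_of_isContained {V' : Type*} [Fintype V'] {G' : SimpleGraph V'}
    [Fintype W] (T : SimpleGraph W) (h : G ⊑ G') :
    G.labelledCopyCount T ≤ G'.labelledCopyCount T := by
  obtain ⟨f⟩ := h
  have hinj : Function.Injective (f.comp : Copy T G → Copy T G') := fun a b hab ↦
    Copy.ext fun x ↦ f.injective (DFunLike.congr_fun hab x)
  rw [labelledCopyCount_eq_natCard, labelledCopyCount_eq_natCard]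
  have : Finite (Copy T G') := DFunLike.finite _
  exact Nat.card_le_card_of_injective _ hinj

theorem genTuranDensity_eq_zero_of_isContained (h : H ⊑ T) : genTuranDensity G T H = 0 := by
  classical
  have hzero : genExtremalNumber G T H = 0 := by
    refine Nat.le_zero.1 (Finset.sup_le fun G' hG' ↦ ?_)
    rw [Nat.le_zero, copyCount_eq_zero]
    exact fun hT ↦ (Finset.mem_filter.1 hG').2 (h.trans hT)
  simp [genTuranDensity, hzero]

theorem labelledCopyCount_div_le_genTuranDensity [Fintype W] (T : SimpleGraph W) (hKG : K ≤ G)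
    (hK : H.Free K) :
    (K.labelledCopyCount T : ℝ) / G.labelledCopyCount T ≤ genTuranDensity G T H := by
  classical
  set G' : G.Subgraph := toSubgraph K hKG
  have hfree : H.Free G'.coe := fun h ↦ hK (h.trans ⟨⟨⟨Subtype.val, id⟩, Subtype.val_injective⟩⟩)
  have hcontained : K ⊑ G'.coe := ⟨⟨⟨fun v ↦ ⟨v, trivial⟩, id⟩, fun _ _ h ↦ congrArg Subtype.val h⟩⟩
  have hex : G'.coe.copyCount T ≤ genExtremalNumber G T H :=
    Finset.le_sup (f := fun G' : G.Subgraph ↦ G'.coe.copyCount T)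
      (Finset.mem_filter.2 ⟨Finset.mem_univ G', hfree⟩)
  have hle := labelledCopyCount_le_of_isContained T hcontained
  rw [labelledCopyCount_eq_copyCount_mul, labelledCopyCount_eq_copyCount_mul] at hle
  have hA : (0 : ℝ) < Nat.card (T ≃g T) := mod_cast card_iso_self_pos T
  rw [labelledCopyCount_eq_copyCount_mul, labelledCopyCount_eq_copyCount_mul, genTuranDensity]
  push_cast
  rw [mul_div_mul_right _ _ hA.ne']
  gcongr
  exact (Nat.le_of_mul_le_mul_right hle (card_iso_self_pos T)).trans hex

-- `H` has no isolated vertices, so the subgraph `G'` may be given all vertices of `G` without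
-- creating a copy of `H`; this replaces subgraphs by graphs `K ≤ G` on the same vertices.
theorem genTuranDensity_le [Fintype W] (hH : H.support = Set.univ) {b : ℝ} (hb : 0 ≤ b)
    (h : ∀ K ≤ G, H.Free K → (K.labelledCopyCount T : ℝ) ≤ b * G.labelledCopyCount T) :
    genTuranDensity G T H ≤ b := by
  classical
  have hbC : 0 ≤ b * G.copyCount T := by positivity
  suffices hex : genExtremalNumber G T H ≤ ⌊b * G.copyCount T⌋₊ from
    div_le_of_le_mul₀ (Nat.cast_nonneg _) hb ((Nat.le_floor_iff hbC).1 hex)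
  refine Finset.sup_le fun G' hG' ↦ Nat.le_floor ?_
  have hfree : H.Free G'.spanningCoe := fun hc ↦
    (Finset.mem_filter.1 hG').2 (isContained_coe_of_isContained_spanningCoe hH hc)
  have hle : (G'.coe.labelledCopyCount T : ℝ) ≤ b * G.labelledCopyCount T :=
    (Nat.cast_le.2 (labelledCopyCount_le_of_isContained T
      ⟨⟨⟨Subtype.val, id⟩, Subtype.val_injective⟩⟩)).trans (h _ G'.spanningCoe_le hfree)
  have hA : (0 : ℝ) < Nat.card (T ≃g T) := mod_cast card_iso_self_pos T
  rw [labelledCopyCount_eq_copyCount_mul, labelledCopyCount_eq_copyCount_mul] at hle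
  push_cast at hle
  rw [← mul_assoc] at hle
  exact le_of_mul_le_mul_right hle hA

end GeneralizedTuran

section LongPaths

variable {V : Type*} [Fintype V]

theorem exists_isPath_of_forall_le_degree {G : SimpleGraph V} [DecidableRel G.Adj] {k : ℕ}
    (hG : G.support.Nonempty) (hdeg : ∀ v ∈ G.support, k ≤ G.degree v) :
    ∃ (u v : V) (p : G.Walk u v), p.IsPath ∧ p.length = k := by
  classical
  suffices h : ∀ r ≤ k, ∃ u ∈ G.support, ∃ (v : V) (p : G.Walk u v), p.IsPath ∧ p.length = r by
    obtain ⟨u, -, v, p, hp⟩ := h k le_rfl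
    exact ⟨u, v, p, hp⟩
  intro r
  induction r with
  | zero => exact fun _ ↦ ⟨_, hG.some_mem, _, .nil, .nil, rfl⟩
  | succ r ih =>
    intro hr
    obtain ⟨u, hu, v, p, hp, hlen⟩ := ih (by lia)
    obtain ⟨w, hw, hwp⟩ : ∃ w ∈ G.neighborFinset u, w ∉ p.support.toFinset.erase u := by
      refine Finset.exists_mem_notMem_of_card_lt_card ?_
      rw [Finset.card_erase_of_mem (by simp), List.toFinset_card_of_nodup hp.support_nodup,
        p.length_support, card_neighborFinset_eq_degree]
      have := hdeg u hu
      lia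
    have huw : G.Adj u w := (mem_neighborFinset _ _ _).1 hw
    refine ⟨w, ⟨u, huw.symm⟩, v, .cons huw.symm p, ?_, by simp [hlen]⟩
    refine (Walk.cons_isPath_iff _ _).2 ⟨hp, fun h ↦ hwp ?_⟩
    exact Finset.mem_erase.2 ⟨huw.ne', List.mem_toFinset.2 h⟩

theorem exists_isPath_of_mul_card_support_lt_card_edgeFinset {G : SimpleGraph V}
    [DecidableRel G.Adj] {k : ℕ} (h : k * Fintype.card G.support < G.edgeFinset.card) :
    ∃ (u v : V) (p : G.Walk u v), p.IsPath ∧ p.length = k + 1 := by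
  classical
  induction hn : Fintype.card G.support using Nat.strong_induction_on generalizing G with
  | _ n ih
  by_cases! hdeg : ∀ v ∈ G.support, k + 1 ≤ G.degree v
  · refine exists_isPath_of_forall_le_degree ?_ hdeg
    rw [Set.nonempty_iff_ne_empty, ne_eq, support_eq_bot_iff]
    exact edgeFinset_nonempty.1 (Finset.card_pos.1 h.pos)
  · obtain ⟨x, hx, hxk⟩ := hdeg
    have hpos : 0 < Fintype.card G.support := Fintype.card_pos_iff.2 ⟨x, hx⟩
    have hcard : Fintype.card (G.deleteIncidenceSet x).support + 1 ≤ Fintype.card G.support := by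
      have := G.card_support_deleteIncidenceSet hx
      lia
    have hlt : k * Fintype.card (G.deleteIncidenceSet x).support <
        (G.deleteIncidenceSet x).edgeFinset.card := by
      have := Nat.mul_le_mul_left k hcard
      rw [Nat.mul_add_one] at this
      rw [card_edgeFinset_deleteIncidenceSet]
      lia
    obtain ⟨u, v, p, hp, hlen⟩ := ih _ (by lia) hlt rfl
    exact ⟨u, v, p.mapLe (G.deleteIncidenceSet_le x), hp.mapLe _, by simpa using hlen⟩

end LongPaths

section FlipBit

variable {ι : Type*} [DecidableEq ι]

/-- The neighbour of the hypercube vertex `v` in direction `i`. -/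
def flipBit (v : ι → Bool) (i : ι) : ι → Bool := Function.update v i (!v i)

theorem flipBit_apply (v : ι → Bool) (i j : ι) :
    flipBit v i j = if j = i then !v j else v j := by
  by_cases h : j = i
  · subst h; simp [flipBit]
  · simp [flipBit, h]

theorem flipBit_flipBit_self (v : ι → Bool) (i : ι) : flipBit (flipBit v i) i = v := by
  simp [flipBit]

theorem flipBit_comm (v : ι → Bool) (i j : ι) :
    flipBit (flipBit v i) j = flipBit (flipBit v j) i := by
  grind [flipBit_apply]

theorem flipBit_ne_self (v : ι → Bool) (i : ι) : flipBit v i ≠ v :=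
  fun h ↦ by simpa [flipBit_apply] using congrFun h i

theorem flipBit_injective (v : ι → Bool) : Function.Injective (flipBit v) := fun i j h ↦ by
  have := congrFun h i
  grind [flipBit_apply]

theorem flipBit_flipBit_ne_flipBit (v : ι → Bool) (i j a : ι) :
    flipBit (flipBit v i) j ≠ flipBit v a := fun h ↦ by
  have hi := congrFun h i
  have hj := congrFun h j
  have ha := congrFun h a
  grind [flipBit_apply]

theorem flipBit_flipBit_eq_self_iff {v : ι → Bool} {i j : ι} :
    flipBit (flipBit v i) j = v ↔ i = j := by
  refine ⟨fun h ↦ flipBit_injective (flipBit v i) ?_, ?_⟩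
  · rw [flipBit_flipBit_self, h]
  · rintro rfl; exact flipBit_flipBit_self v i

theorem flipBit_flipBit_eq_iff {v : ι → Bool} {i j a b : ι} (hij : i ≠ j) :
    flipBit (flipBit v i) j = flipBit (flipBit v a) b ↔ i = a ∧ j = b ∨ i = b ∧ j = a := by
  refine ⟨fun h ↦ ?_, ?_⟩
  · have hi := congrFun h i
    have hj := congrFun h j
    grind [flipBit_apply]
  · rintro (⟨rfl, rfl⟩ | ⟨rfl, rfl⟩)
    exacts [rfl, flipBit_comm v i j]

theorem flipBit_induction [Finite ι] {P : (ι → Bool) → Prop} (bot : P ⊥)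
    (flip : ∀ i, P (flipBit ⊥ i))
    (square : ∀ z i j, i ≠ j → P z → P (flipBit z i) → P (flipBit z j) →
      P (flipBit (flipBit z i) j)) (x : ι → Bool) : P x := by
  have lt_flipBit {y : ι → Bool} {i : ι} (hi : y i = false) : y < flipBit y i := by
    simp [flipBit, hi]
  have exists_eq_flipBit {y : ι → Bool} (hy : y ≠ ⊥) : ∃ z i, z i = false ∧ y = flipBit z i := by
    obtain ⟨i, hi⟩ : ∃ i, y i = true := by simpa [funext_iff] using hy
    exact ⟨flipBit y i, i, by simp [flipBit_apply, hi], (flipBit_flipBit_self y i).symm⟩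
  induction x using WellFoundedLT.induction with
  | _ x ih
  obtain rfl | hx := eq_or_ne x ⊥
  · exact bot
  obtain ⟨y, j, hyj, rfl⟩ := exists_eq_flipBit hx
  obtain rfl | hy := eq_or_ne y ⊥
  · exact flip j
  obtain ⟨z, i, hzi, rfl⟩ := exists_eq_flipBit hy
  have hij : i ≠ j := by rintro rfl; simp [flipBit_apply, hzi] at hyj
  have hzi_lt : flipBit z i < flipBit (flipBit z i) j := lt_flipBit hyj
  have hzj_lt : flipBit z j < flipBit (flipBit z i) j := by
    rw [flipBit_comm]
    exact lt_flipBit (by simp [flipBit_apply, hij, hzi])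
  exact square z i j hij (ih _ ((lt_flipBit hzi).trans hzi_lt)) (ih _ hzi_lt) (ih _ hzj_lt)

end FlipBit

section Subcube

variable {ι κ : Type*}

/-- The parametrization of the subcube through `v` whose directions are the values of `σ`, with
origin `v`. -/
noncomputable def subcubeMap (v : ι → Bool) (σ : κ → ι) (x : κ → Bool) : ι → Bool :=
  Function.extend σ (fun i ↦ xor (v (σ i)) (x i)) v

theorem subcubeMap_apply (v : ι → Bool) (σ : κ ↪ ι) (x : κ → Bool) (i : κ) :
    subcubeMap v σ x (σ i) = xor (v (σ i)) (x i) :=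
  σ.injective.extend_apply _ _ i

theorem subcubeMap_apply_of_notMem_range {v : ι → Bool} {σ : κ → ι} {j : ι}
    (hj : j ∉ Set.range σ) (x : κ → Bool) : subcubeMap v σ x j = v j :=
  Function.extend_apply' _ _ _ hj

theorem subcubeMap_bot (v : ι → Bool) (σ : κ ↪ ι) : subcubeMap v σ ⊥ = v := by
  ext j
  by_cases hj : j ∈ Set.range σ
  · obtain ⟨i, rfl⟩ := hj
    simp [subcubeMap_apply]
  · rw [subcubeMap_apply_of_notMem_range hj]

theorem subcubeMap_flipBit [DecidableEq ι] [DecidableEq κ] (v : ι → Bool) (σ : κ ↪ ι)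
    (x : κ → Bool) (i : κ) :
    subcubeMap v σ (flipBit x i) = flipBit (subcubeMap v σ x) (σ i) := by
  ext j
  by_cases hj : j ∈ Set.range σ
  · obtain ⟨l, rfl⟩ := hj
    simp only [subcubeMap_apply, flipBit_apply, EmbeddingLike.apply_eq_iff_eq]
    split_ifs <;> simp
  · have hij : j ≠ σ i := fun h ↦ hj ⟨i, h.symm⟩
    simp [subcubeMap_apply_of_notMem_range hj, flipBit_apply, hij]

theorem subcubeMap_injective (v : ι → Bool) (σ : κ ↪ ι) :
    Function.Injective (subcubeMap v σ) := fun x y h ↦ by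
  ext i
  simpa [subcubeMap_apply] using congrFun h (σ i)

end Subcube

section Hypercube

variable {ℓ n : ℕ}

theorem hypercube_adj_iff {u v : Fin n → Bool} :
    (hypercube n).Adj u v ↔ ∃ i, v = flipBit u i := by
  change hammingDist u v = 1 ↔ _
  rw [hammingDist, Finset.card_eq_one]
  refine exists_congr fun i ↦ ?_
  simp only [Finset.ext_iff, funext_iff, Finset.mem_filter_univ, Finset.mem_singleton]
  refine forall_congr' fun j ↦ ?_
  by_cases hj : j = i <;> simp [flipBit_apply, hj, Bool.eq_not, eq_comm]

theorem hypercube_adj_flipBit (v : Fin n → Bool) (i : Fin n) :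
    (hypercube n).Adj v (flipBit v i) :=
  hypercube_adj_iff.2 ⟨i, rfl⟩

theorem eq_flipBit_flipBit_of_adj {v w : Fin n → Bool} {i j : Fin n} (hij : i ≠ j) (hw : w ≠ v)
    (hi : (hypercube n).Adj (flipBit v i) w) (hj : (hypercube n).Adj (flipBit v j) w) :
    w = flipBit (flipBit v i) j := by
  obtain ⟨a, rfl⟩ := hypercube_adj_iff.1 hi
  obtain ⟨b, hb⟩ := hypercube_adj_iff.1 hj
  have hia : i ≠ a := fun h ↦ hw (flipBit_flipBit_eq_self_iff.2 h)
  rcases (flipBit_flipBit_eq_iff hia).1 hb with ⟨h, -⟩ | ⟨-, rfl⟩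
  exacts [absurd h hij, rfl]

-- Vertices at distance two have exactly two common neighbours, so three corners of a square
-- determine the fourth.
theorem copy_hypercube_ext {f g : Copy (hypercube ℓ) (hypercube n)} (hbot : f ⊥ = g ⊥)
    (hflip : ∀ i, f (flipBit ⊥ i) = g (flipBit ⊥ i)) : f = g := by
  have hadj (h : Copy (hypercube ℓ) (hypercube n)) (y : Fin ℓ → Bool) (i : Fin ℓ) :
      (hypercube n).Adj (h y) (h (flipBit y i)) := h.toHom.map_adj (hypercube_adj_flipBit y i)
  refine Copy.ext fun x ↦ ?_
  induction x using flipBit_induction with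
  | bot => exact hbot
  | flip i => exact hflip i
  | square z i j hij hz hi hj =>
    obtain ⟨a, ha⟩ := hypercube_adj_iff.1 (hadj f z i)
    obtain ⟨b, hb⟩ := hypercube_adj_iff.1 (hadj f z j)
    have hab : a ≠ b := by
      rintro rfl
      exact hij (flipBit_injective z (f.injective (ha.trans hb.symm)))
    have key (h : Copy (hypercube ℓ) (hypercube n)) (hz : h z = f z)
        (hi : h (flipBit z i) = f (flipBit z i)) (hj : h (flipBit z j) = f (flipBit z j)) :
        h (flipBit (flipBit z i) j) = flipBit (flipBit (f z) a) b := by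
      refine eq_flipBit_flipBit_of_adj hab ?_ ?_ ?_
      · rw [← hz]
        exact h.injective.ne (mt flipBit_flipBit_eq_self_iff.1 hij)
      · rw [← ha, ← hi]
        exact hadj h _ j
      · rw [← hb, ← hj, flipBit_comm]
        exact hadj h _ i
    rw [key f rfl rfl rfl, key g hz.symm hi.symm hj.symm]

/-- The copies of `Q_ℓ` in `Q_n` are the subcubes: a copy is determined by the image of the origin
and by the directions of the edges leaving it. -/
noncomputable def subcubeEquiv (ℓ n : ℕ) :
    (Fin n → Bool) × (Fin ℓ ↪ Fin n) ≃ Copy (hypercube ℓ) (hypercube n) :=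
  Equiv.ofBijective
    (fun p ↦ ⟨⟨subcubeMap p.1 p.2, fun hadj ↦ by
      obtain ⟨i, rfl⟩ := hypercube_adj_iff.1 hadj
      rw [subcubeMap_flipBit]
      exact hypercube_adj_flipBit _ _⟩, subcubeMap_injective p.1 p.2⟩) <| by
    constructor
    · rintro ⟨v, σ⟩ ⟨w, τ⟩ h
      have happly (x) : subcubeMap v σ x = subcubeMap w τ x := DFunLike.congr_fun h x
      obtain rfl : v = w := by simpa only [subcubeMap_bot] using happly ⊥
      obtain rfl : σ = τ := by
        ext1 i
        apply flipBit_injective v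
        simpa only [subcubeMap_flipBit, subcubeMap_bot] using happly (flipBit ⊥ i)
      rfl
    · intro f
      have hadj (i) := f.toHom.map_adj (hypercube_adj_flipBit ⊥ i)
      choose σ hσ using fun i ↦ hypercube_adj_iff.1 (hadj i)
      have hinj : Function.Injective σ := fun i j hij ↦
        flipBit_injective ⊥ <| f.injective <| by
          exact (hσ i).trans (hij ▸ (hσ j).symm)
      exact ⟨(f ⊥, ⟨σ, hinj⟩), copy_hypercube_ext (subcubeMap_bot _ ⟨σ, hinj⟩) fun i ↦
        (subcubeMap_flipBit _ ⟨σ, hinj⟩ ⊥ i).trans <| by rw [subcubeMap_bot]; exact (hσ i).symm⟩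

theorem labelledCopyCount_hypercube (ℓ n : ℕ) :
    (hypercube n).labelledCopyCount (hypercube ℓ) = 2 ^ n * n.descFactorial ℓ := by
  rw [labelledCopyCount_eq_natCard, ← Nat.card_congr (subcubeEquiv ℓ n)]
  simp [Fintype.card_embedding_eq]

end Hypercube

section Ladder

variable {V W : Type*} {G : SimpleGraph V} {G' : SimpleGraph W}

theorem cycleGraph_isContained_of_isPath {u v : V} {p : G.Walk u v} (hp : p.IsPath)
    (hlen : 2 ≤ p.length) (h : G.Adj v u) : cycleGraph (p.length + 1) ⊑ G := by
  refine (cycleGraph_isContained_iff (by lia)).2 ⟨v, .cons h p, ?_, rfl⟩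
  refine (Walk.cons_isCycle_iff p h).2 ⟨hp, fun hmem ↦ ?_⟩
  have := hp.length_eq_one_of_mem_edges (Sym2.eq_swap ▸ hmem)
  lia

theorem exists_isPath_ladder {f g : G ↪g G'} (hfg : ∀ x y, f x ≠ g y)
    (hadj : ∀ x, G'.Adj (f x) (g x)) {u v : V} {p : G.Walk u v} (hp : p.IsPath) :
    ∃ q : G'.Walk (f u) (g u), q.IsPath ∧ q.length = 2 * p.length + 1 := by
  refine ⟨(p.map f.toHom).append (.cons (hadj v) (p.map g.toHom).reverse), ?_, ?_⟩
  · rw [Walk.isPath_def, Walk.support_append, Walk.support_cons, List.tail_cons,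
      List.nodup_append', Walk.support_reverse, List.nodup_reverse]
    refine ⟨(hp.map f.injective).support_nodup, (hp.map g.injective).support_nodup, ?_⟩
    simpa [List.disjoint_left] using fun x _ y _ ↦ (hfg x y).symm
  · simp
    lia

end Ladder

section HypercubeCycles

variable {n : ℕ}

/-- The embedding of `Q_n` as the facet of `Q_{n + 1}` whose first coordinate is `b`. -/
def hypercubeCons (b : Bool) : hypercube n ↪g hypercube (n + 1) where
  toFun x := Fin.cons b x
  inj' := Fin.cons_right_injective (α := fun _ ↦ Bool) b
  map_rel_iff' := by
    intro x y
    change hammingDist (Fin.cons b x : Fin (n + 1) → Bool) (Fin.cons b y) = 1 ↔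
      hammingDist x y = 1
    simp [hammingDist, Finset.card_filter, Fin.sum_univ_succ]

theorem hypercubeCons_ne (x y : Fin n → Bool) : hypercubeCons false x ≠ hypercubeCons true y :=
  fun h ↦ Bool.false_ne_true (congrFun h (0 : Fin (n + 1)))

theorem adj_hypercubeCons (x : Fin n → Bool) :
    (hypercube (n + 1)).Adj (hypercubeCons false x) (hypercubeCons true x) :=
  hypercube_adj_iff.2 ⟨0, (Fin.update_cons_zero (α := fun _ ↦ Bool) false x true).symm⟩

theorem exists_isPath_hypercube_of_lt {r : ℕ} (hr : r < 2 ^ n) :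
    ∃ (u v : Fin n → Bool) (p : (hypercube n).Walk u v), p.IsPath ∧ p.length = r := by
  suffices h : ∃ (u v : Fin n → Bool) (p : (hypercube n).Walk u v),
      p.IsPath ∧ p.length + 1 = 2 ^ n by
    obtain ⟨u, v, p, hp, hlen⟩ := h
    exact ⟨u, _, p.take r, hp.take r, by rw [Walk.take_length]; lia⟩
  clear hr
  induction n with
  | zero => exact ⟨⊥, ⊥, .nil, .nil, rfl⟩
  | succ n ih =>
    obtain ⟨u, v, p, hp, hlen⟩ := ih
    obtain ⟨q, hq, hqlen⟩ := exists_isPath_ladder hypercubeCons_ne adj_hypercubeCons hp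
    exact ⟨_, _, q, hq, by rw [pow_succ]; lia⟩

theorem cycleGraph_isContained_hypercube {k : ℕ} (hk : 2 ≤ k) (h : 2 * k ≤ 2 ^ n) :
    cycleGraph (2 * k) ⊑ hypercube n := by
  obtain _ | n := n
  · lia
  obtain ⟨r, rfl⟩ : ∃ r, k = r + 1 := ⟨k - 1, by lia⟩
  obtain ⟨u, v, p, hp, rfl⟩ := exists_isPath_hypercube_of_lt (n := n) (r := r) (by lia)
  obtain ⟨q, hq, hqlen⟩ := exists_isPath_ladder hypercubeCons_ne adj_hypercubeCons hp
  have := cycleGraph_isContained_of_isPath hq (by lia) (adj_hypercubeCons u).symm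
  rwa [hqlen] at this

end HypercubeCycles

section SquareGraph

variable {ι : Type*} [DecidableEq ι]

/-- The graph of two-dimensional faces at `v` inside `K`: the directions `i` and `j` are adjacent
when the four edges of the square spanned at `v` by `i` and `j` all lie in `K`. A path in this graph
unfolds to a zigzag in `K` between the first and the second neighbourhood of `v`. -/
def squareGraph (K : SimpleGraph (ι → Bool)) (v : ι → Bool) : SimpleGraph ι where
  Adj i j := i ≠ j ∧ K.Adj v (flipBit v i) ∧ K.Adj v (flipBit v j) ∧
    K.Adj (flipBit v i) (flipBit (flipBit v i) j) ∧ K.Adj (flipBit v j) (flipBit (flipBit v i) j)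
  symm := ⟨fun i j ⟨hij, hi, hj, hij₁, hij₂⟩ ↦
    ⟨hij.symm, hj, hi, flipBit_comm v i j ▸ hij₂, flipBit_comm v i j ▸ hij₁⟩⟩
  loopless := ⟨fun _ h ↦ h.1 rfl⟩

variable {K : SimpleGraph (ι → Bool)} {v : ι → Bool}

theorem exists_isPath_zigzag {i j : ι} {p : (squareGraph K v).Walk i j} (hp : p.IsPath) :
    ∃ q : K.Walk (flipBit v i) (flipBit v j), q.IsPath ∧ q.length = 2 * p.length ∧
      ∀ x ∈ q.support, ∃ a ∈ p.support, x = flipBit v a ∨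
        ∃ b ∈ p.support, a ≠ b ∧ x = flipBit (flipBit v a) b := by
  induction p with
  | nil =>
    exact ⟨.nil, .nil, rfl, fun x hx ↦ ⟨_, Walk.start_mem_support _, .inl (by simpa using hx)⟩⟩
  | @cons i i' j h p ih =>
    obtain ⟨hp, hi⟩ := (Walk.cons_isPath_iff _ _).1 hp
    obtain ⟨q, hq, hlen, hsupp⟩ := ih hp
    have hi' : i' ∈ p.support := p.start_mem_support
    have hv₁ : flipBit v i ∉ q.support := fun hmem ↦ by
      obtain ⟨a, ha, hx | ⟨b, -, -, hx⟩⟩ := hsupp _ hmem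
      · exact hi (flipBit_injective v hx ▸ ha)
      · exact flipBit_flipBit_ne_flipBit v a b i hx.symm
    have hv₂ : flipBit (flipBit v i) i' ∉ q.support := fun hmem ↦ by
      obtain ⟨a, ha, hx | ⟨b, hb, -, hx⟩⟩ := hsupp _ hmem
      · exact flipBit_flipBit_ne_flipBit v i i' a hx
      · rcases (flipBit_flipBit_eq_iff h.1).1 hx with ⟨rfl, -⟩ | ⟨rfl, -⟩
        exacts [hi ha, hi hb]
    refine ⟨.cons h.2.2.2.1 (.cons h.2.2.2.2.symm q), ?_, by simp [hlen]; lia, fun x hx ↦ ?_⟩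
    · simp only [Walk.cons_isPath_iff, Walk.support_cons, List.mem_cons, not_or]
      exact ⟨⟨hq, hv₂⟩, (flipBit_flipBit_ne_flipBit v i i' i).symm, hv₁⟩
    · simp only [Walk.support_cons, List.mem_cons] at hx ⊢
      rcases hx with rfl | rfl | hx
      · exact ⟨i, .inl rfl, .inl rfl⟩
      · exact ⟨i, .inl rfl, .inr ⟨i', .inr hi', h.1, rfl⟩⟩
      · obtain ⟨a, ha, hx | ⟨b, hb, hab, hx⟩⟩ := hsupp x hx
        exacts [⟨a, .inr ha, .inl hx⟩, ⟨a, .inr ha, .inr ⟨b, .inr hb, hab, hx⟩⟩]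

theorem cycleGraph_isContained_of_isPath_squareGraph {i j : ι} {p : (squareGraph K v).Walk i j}
    (hp : p.IsPath) (hlen : p.length ≠ 0) : cycleGraph (2 * (p.length + 1)) ⊑ K := by
  obtain ⟨q, hq, hqlen, hsupp⟩ := exists_isPath_zigzag hp
  have hnil : ¬p.Nil := mt Walk.length_eq_zero_iff.2 hlen
  have hvi : K.Adj v (flipBit v i) := (p.adj_snd hnil).2.1
  have hvj : K.Adj v (flipBit v j) := (p.adj_penultimate hnil).2.2.1
  have hv : v ∉ q.support := fun hmem ↦ by
    obtain ⟨a, -, hx | ⟨b, -, hab, hx⟩⟩ := hsupp _ hmem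
    exacts [flipBit_ne_self v a hx.symm, hab (flipBit_flipBit_eq_self_iff.1 hx.symm)]
  have hcycle := cycleGraph_isContained_of_isPath (p := .cons hvi q)
    ((Walk.cons_isPath_iff _ _).2 ⟨hq, hv⟩) (by rw [Walk.length_cons]; lia) hvj.symm
  rwa [Walk.length_cons, hqlen] at hcycle

theorem card_edgeFinset_squareGraph_le [Fintype ι] [DecidableRel (squareGraph K v).Adj] {r : ℕ}
    (hK : (cycleGraph (2 * (r + 2))).Free K) :
    (squareGraph K v).edgeFinset.card ≤ r * Fintype.card ι := by
  by_contra! hlt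
  obtain ⟨i, j, p, hp, hlen⟩ := exists_isPath_of_mul_card_support_lt_card_edgeFinset
    ((Nat.mul_le_mul_left r (set_fintype_card_le_univ _)).trans_lt hlt)
  refine hK ?_
  have := cycleGraph_isContained_of_isPath_squareGraph hp (by lia)
  rwa [hlen] at this

end SquareGraph

section UpperBound

variable {ℓ n : ℕ} {K : SimpleGraph (Fin n → Bool)}

theorem exists_coe_copy_eq_subcubeMap (hK : K ≤ hypercube n) (f : Copy (hypercube ℓ) K) :
    ∃ (v : Fin n → Bool) (σ : Fin ℓ ↪ Fin n), ⇑f = subcubeMap v σ := by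
  obtain ⟨⟨v, σ⟩, h⟩ := (subcubeEquiv ℓ n).surjective ((Copy.ofLE K _ hK).comp f)
  exact ⟨v, σ, funext fun x ↦ (DFunLike.congr_fun h x).symm⟩

theorem squareGraph_adj_of_coe_eq_subcubeMap {f : hypercube ℓ →g K} {v : Fin n → Bool}
    {σ : Fin ℓ ↪ Fin n} (hf : ⇑f = subcubeMap v σ) {i j : Fin ℓ} (hij : i ≠ j) :
    (squareGraph K v).Adj (σ i) (σ j) := by
  have hadj (x : Fin ℓ → Bool) (a : Fin ℓ) :
      K.Adj (subcubeMap v σ x) (flipBit (subcubeMap v σ x) (σ a)) := by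
    rw [← subcubeMap_flipBit, ← hf]
    exact f.map_adj (hypercube_adj_flipBit x a)
  have hbot := hadj ⊥
  have hi := hadj (flipBit ⊥ i) j
  have hj := hadj (flipBit ⊥ j) i
  rw [subcubeMap_flipBit, flipBit_comm] at hj
  simp only [subcubeMap_flipBit, subcubeMap_bot] at hbot hi hj
  exact ⟨σ.injective.ne hij, hbot i, hbot j, hi, flipBit_comm v _ _ ▸ hj⟩

open Classical in
theorem labelledCopyCount_hypercube_le {e : ℕ} (hK : K ≤ hypercube n)
    (he : ∀ v, (squareGraph K v).edgeFinset.card ≤ e) (ℓ : ℕ) :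
    K.labelledCopyCount (hypercube (ℓ + 2)) ≤ 2 ^ n * (2 * e * n ^ ℓ) := by
  choose v σ hf using exists_coe_copy_eq_subcubeMap (ℓ := ℓ + 2) hK
  -- The first two directions of a copy form a dart of the square graph at its origin.
  let F (f : Copy (hypercube (ℓ + 2)) K) :
      Σ v : Fin n → Bool, (squareGraph K v).Dart × (Fin ℓ → Fin n) :=
    ⟨v f, ⟨(σ f 0, σ f 1), squareGraph_adj_of_coe_eq_subcubeMap (f := f.toHom) (hf f) (by simp)⟩,
      fun i ↦ σ f i.succ.succ⟩
  have hF : Function.Injective F := fun f g hfg ↦ by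
    have hv : v f = v g := congrArg Sigma.fst hfg
    have h₀ : σ f 0 = σ g 0 := congrArg (fun y ↦ y.2.1.fst) hfg
    have h₁ : σ f 1 = σ g 1 := congrArg (fun y ↦ y.2.1.snd) hfg
    have htail (i : Fin ℓ) : σ f i.succ.succ = σ g i.succ.succ :=
      congrFun (congrArg (fun y ↦ y.2.2) hfg) i
    have hσ : σ f = σ g := by
      ext1 i
      exact Fin.cases h₀ (Fin.cases h₁ htail) i
    exact DFunLike.coe_injective (by rw [hf, hf, hv, hσ])
  calc K.labelledCopyCount (hypercube (ℓ + 2))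
      ≤ Nat.card (Σ v : Fin n → Bool, (squareGraph K v).Dart × (Fin ℓ → Fin n)) := by
        rw [labelledCopyCount_eq_natCard]
        exact Nat.card_le_card_of_injective F hF
    _ = ∑ v, 2 * (squareGraph K v).edgeFinset.card * n ^ ℓ := by
        simp [dart_card_eq_twice_card_edges]
    _ ≤ ∑ _v : Fin n → Bool, 2 * e * n ^ ℓ := by gcongr; exact he _
    _ = 2 ^ n * (2 * e * n ^ ℓ) := by simp

theorem pow_le_pow_self_mul_descFactorial (h : ℓ ≤ n) : n ^ ℓ ≤ ℓ ^ ℓ * n.descFactorial ℓ := by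
  obtain rfl | hℓ := Nat.eq_zero_or_pos ℓ
  · simp
  have hn : n ≤ ℓ * (n + 1 - ℓ) := by
    obtain ⟨d, rfl⟩ := Nat.exists_eq_add_of_le h
    rw [show ℓ + d + 1 - ℓ = d + 1 by lia]
    nlinarith
  calc n ^ ℓ ≤ (ℓ * (n + 1 - ℓ)) ^ ℓ := Nat.pow_le_pow_left hn ℓ
    _ = ℓ ^ ℓ * (n + 1 - ℓ) ^ ℓ := mul_pow _ _ _
    _ ≤ ℓ ^ ℓ * n.descFactorial ℓ := Nat.mul_le_mul_left _ (Nat.pow_sub_le_descFactorial n ℓ)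

theorem genTuranDensity_hypercube_le {k : ℕ} (hk : 2 ≤ k) (hℓ : 2 ≤ ℓ) (hℓn : ℓ ≤ n) :
    genTuranDensity (hypercube n) (hypercube ℓ) (cycleGraph (2 * k)) ≤
      2 * k * ℓ ^ ℓ * (n : ℝ)⁻¹ := by
  classical
  obtain ⟨r, rfl⟩ := Nat.exists_eq_add_of_le' hk
  obtain ⟨ℓ, rfl⟩ := Nat.exists_eq_add_of_le' hℓ
  have hsupp : (cycleGraph (2 * (r + 2))).support = Set.univ := by
    have : Nontrivial (Fin (2 * (r + 2))) := Fin.nontrivial_iff_two_le.2 (by lia)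
    exact cycleGraph_preconnected.support_eq_univ
  refine genTuranDensity_le hsupp (by positivity) fun K hK hfree ↦ ?_
  have hsquare (v) : (squareGraph K v).edgeFinset.card ≤ r * n := by
    simpa using card_edgeFinset_squareGraph_le (v := v) hfree
  have hn : (n : ℝ) ≠ 0 := by
    have : n ≠ 0 := by lia
    exact_mod_cast this
  rw [labelledCopyCount_hypercube]
  calc (K.labelledCopyCount (hypercube (ℓ + 2)) : ℝ)
      ≤ 2 ^ n * (2 * (r * n) * n ^ ℓ) := mod_cast labelledCopyCount_hypercube_le hK hsquare ℓ
    _ = 2 * r * (2 ^ n * n ^ (ℓ + 2)) * (n : ℝ)⁻¹ := by field_simp; ring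
    _ ≤ 2 * (r + 2 : ℕ) *
          (2 ^ n * ((ℓ + 2 : ℕ) ^ (ℓ + 2) * n.descFactorial (ℓ + 2))) * (n : ℝ)⁻¹ := by
        gcongr
        · lia
        · exact_mod_cast pow_le_pow_self_mul_descFactorial hℓn
    _ = _ := by push_cast; ring

end UpperBound

section LowerBound

variable {ℓ n : ℕ}

/-- The subgraph of `Q_n` formed by the edges whose direction lies in `D`: a disjoint union of
subcubes of dimension `#D`. -/
def directionGraph (D : Finset (Fin n)) : SimpleGraph (Fin n → Bool) where
  Adj u v := (hypercube n).Adj u v ∧ ∀ i ∉ D, u i = v i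
  symm := ⟨fun _ _ ⟨hadj, h⟩ ↦ ⟨hadj.symm, fun i hi ↦ (h i hi).symm⟩⟩
  loopless := ⟨fun _ h ↦ h.1.ne rfl⟩

variable {D : Finset (Fin n)}

theorem directionGraph_le : directionGraph D ≤ hypercube n := fun _ _ h ↦ h.1

theorem apply_eq_apply_of_reachable_directionGraph {u v : Fin n → Bool}
    (h : (directionGraph D).Reachable u v) {i : Fin n} (hi : i ∉ D) : u i = v i := by
  obtain ⟨p⟩ := h
  induction p with
  | nil => rfl
  | cons hadj _ ih => exact (hadj.2 i hi).trans ih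

theorem card_le_two_pow_of_isContained_directionGraph {W : Type*} [Fintype W]
    {T : SimpleGraph W} (hT : T.Preconnected) (h : T ⊑ directionGraph D) :
    Fintype.card W ≤ 2 ^ D.card := by
  obtain ⟨f⟩ := h
  have hinj : Function.Injective fun (w : W) (i : D) ↦ f w i := fun w w' hww' ↦ by
    refine f.injective (funext fun i ↦ ?_)
    by_cases hi : i ∈ D
    · exact congrFun hww' ⟨i, hi⟩
    · exact apply_eq_apply_of_reachable_directionGraph ((hT w w').map f.toHom) hi
  simpa using Fintype.card_le_of_injective _ hinj

theorem le_labelledCopyCount_directionGraph (D : Finset (Fin n)) (ℓ : ℕ) :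
    2 ^ n * D.card.descFactorial ℓ ≤ (directionGraph D).labelledCopyCount (hypercube ℓ) := by
  let τ (σ : Fin ℓ ↪ D) : Fin ℓ ↪ Fin n := σ.trans (.subtype _)
  let F (p : (Fin n → Bool) × (Fin ℓ ↪ D)) : Copy (hypercube ℓ) (directionGraph D) :=
    ⟨⟨subcubeMap p.1 (τ p.2), fun hadj ↦ by
      refine ⟨(subcubeEquiv ℓ n (p.1, τ p.2)).toHom.map_adj hadj, fun i hi ↦ ?_⟩
      have hiσ : i ∉ Set.range (τ p.2) := by
        rintro ⟨j, rfl⟩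
        exact hi (p.2 j).2
      rw [subcubeMap_apply_of_notMem_range hiσ, subcubeMap_apply_of_notMem_range hiσ]⟩,
    subcubeMap_injective _ _⟩
  have hF : Function.Injective F := by
    rintro ⟨v, σ⟩ ⟨w, ρ⟩ h
    have hcopy : subcubeEquiv ℓ n (v, τ σ) = subcubeEquiv ℓ n (w, τ ρ) :=
      Copy.ext fun x ↦ DFunLike.congr_fun h x
    obtain ⟨rfl, hτ⟩ := Prod.mk.inj ((subcubeEquiv ℓ n).injective hcopy)
    obtain rfl : σ = ρ := by
      ext i
      exact congrArg Fin.val (DFunLike.congr_fun hτ i)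
    rfl
  have : Finite (Copy (hypercube ℓ) (directionGraph D)) := DFunLike.finite _
  rw [labelledCopyCount_eq_natCard]
  simpa [Fintype.card_embedding_eq] using Nat.card_le_card_of_injective F hF

theorem choose_mul_inv_choose_le_genTuranDensity {W : Type*} [Fintype W] {H : SimpleGraph W}
    (hH : H.Preconnected) {m : ℕ} (hm : 2 ^ m < Fintype.card W) (hmn : m ≤ n) (ℓ : ℕ) :
    (m.choose ℓ : ℝ) * (n.choose ℓ : ℝ)⁻¹ ≤ genTuranDensity (hypercube n) (hypercube ℓ) H := by
  obtain ⟨D, -, rfl⟩ : ∃ D ⊆ (Finset.univ : Finset (Fin n)), D.card = m :=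
    Finset.exists_subset_card_eq (by simpa using hmn)
  have hfree : H.Free (directionGraph D) := fun h ↦
    hm.not_ge (card_le_two_pow_of_isContained_directionGraph hH h)
  calc (D.card.choose ℓ : ℝ) * (n.choose ℓ : ℝ)⁻¹
      = (2 ^ n * D.card.descFactorial ℓ) / (2 ^ n * n.descFactorial ℓ) := by
        have hℓ : (ℓ.factorial : ℝ) ≠ 0 := mod_cast ℓ.factorial_ne_zero
        simp only [Nat.descFactorial_eq_factorial_mul_choose, Nat.cast_mul]
        rw [mul_div_mul_left _ _ (by positivity), mul_div_mul_left _ _ hℓ, div_eq_mul_inv]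
    _ ≤ (directionGraph D).labelledCopyCount (hypercube ℓ) /
          (hypercube n).labelledCopyCount (hypercube ℓ) := by
        rw [labelledCopyCount_hypercube]
        push_cast
        gcongr
        exact_mod_cast le_labelledCopyCount_directionGraph D ℓ
    _ ≤ _ := labelledCopyCount_div_le_genTuranDensity _ directionGraph_le hfree

end LowerBound

section Logarithm

theorem logb_two_le_natCast_iff {k n : ℕ} (hk : 1 ≤ k) :
    Real.logb 2 (2 * (k : ℝ)) ≤ n ↔ 2 * k ≤ 2 ^ n := by
  have hpos : (0 : ℝ) < 2 * k := by positivity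
  rw [Real.logb_le_iff_le_rpow one_lt_two hpos, Real.rpow_natCast]
  exact_mod_cast Iff.rfl

theorem inv_natCast_le_rpow_neg (n : ℕ) {s : ℝ} (hs : s ≤ 1) : (n : ℝ)⁻¹ ≤ (n : ℝ) ^ (-s) := by
  obtain rfl | hn := Nat.eq_zero_or_pos n
  · simpa using Real.zero_rpow_nonneg (-s)
  · rw [← Real.rpow_neg_one]
    exact Real.rpow_le_rpow_of_exponent_le (mod_cast hn) (neg_le_neg hs)

end Logarithm

theorem theorem4_general {k : ℕ} (hk : 2 ≤ k) :
    (∀ ℓ n : ℕ, Real.logb 2 (2 * (k : ℝ)) ≤ (ℓ : ℝ) →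
      genTuranDensity (hypercube n) (hypercube ℓ) (cycleGraph (2 * k)) = 0) ∧
    ∃ c : ℝ, 0 < c ∧ ∀ ℓ n m : ℕ, 2 ≤ ℓ → (ℓ : ℝ) < Real.logb 2 (2 * (k : ℝ)) →
      Real.logb 2 (2 * (k : ℝ)) ≤ (n : ℝ) → (m : ℤ) = ⌈Real.logb 2 (2 * (k : ℝ))⌉ - 1 →
      (m.choose ℓ : ℝ) * (n.choose ℓ : ℝ)⁻¹ ≤
          genTuranDensity (hypercube n) (hypercube ℓ) (cycleGraph (2 * k)) ∧
        genTuranDensity (hypercube n) (hypercube ℓ) (cycleGraph (2 * k)) ≤ c * (n : ℝ)⁻¹ := by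
  have hlog (d : ℕ) := logb_two_le_natCast_iff (n := d) (one_le_two.trans hk)
  refine ⟨fun ℓ n hℓ ↦ genTuranDensity_eq_zero_of_isContained
    (cycleGraph_isContained_hypercube hk ((hlog ℓ).1 hℓ)),
    2 * k * (2 * k) ^ (2 * k), by positivity, fun ℓ n m hℓ₂ hℓ hn hm ↦ ⟨?_, ?_⟩⟩
  · have hmlog : (m : ℝ) < Real.logb 2 (2 * k) := by
      exact_mod_cast Int.lt_ceil.1 (show (m : ℤ) < ⌈Real.logb 2 (2 * (k : ℝ))⌉ by lia)
    have hmk : 2 ^ m < 2 * k := not_le.1 (mt (hlog m).2 hmlog.not_ge)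
    exact choose_mul_inv_choose_le_genTuranDensity cycleGraph_preconnected (by simpa using hmk)
      (mod_cast (hmlog.trans_le hn).le) ℓ
  · have hℓk : ℓ ≤ 2 * k :=
      (Nat.lt_two_pow_self.trans (not_le.1 (mt (hlog ℓ).2 hℓ.not_ge))).le
    have hpow : (ℓ : ℝ) ^ ℓ ≤ (2 * k) ^ (2 * k) := mod_cast Nat.pow_self_mono hℓk
    refine (genTuranDensity_hypercube_le hk hℓ₂ (mod_cast (hℓ.trans_le hn).le)).trans ?_
    gcongr

theorem theorem4 :
    (∀ k ℓ n : ℕ, 2 ≤ k → Real.logb 2 (2 * (k : ℝ)) ≤ (ℓ : ℝ) →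
      genTuranDensity (hypercube n) (hypercube ℓ) (SimpleGraph.cycleGraph (2 * k)) = 0) ∧
    (∀ k : ℕ, 4 ≤ k → k ≠ 5 → ∃ c : ℝ, 0 < c ∧
      ∀ ℓ n m : ℕ, 2 ≤ ℓ → (ℓ : ℝ) < Real.logb 2 (2 * (k : ℝ)) →
        Real.logb 2 (2 * (k : ℝ)) ≤ (n : ℝ) →
        (m : ℤ) = ⌈Real.logb 2 (2 * (k : ℝ))⌉ - 1 →
        (m.choose ℓ : ℝ) * ((n.choose ℓ : ℝ))⁻¹ ≤
            genTuranDensity (hypercube n) (hypercube ℓ) (SimpleGraph.cycleGraph (2 * k)) ∧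
          genTuranDensity (hypercube n) (hypercube ℓ) (SimpleGraph.cycleGraph (2 * k)) ≤
            c * (n : ℝ) ^ (-(1 / 16 : ℝ))) := by
  refine ⟨fun k ℓ n hk ↦ (theorem4_general hk).1 ℓ n, fun k hk _ ↦ ?_⟩
  obtain ⟨c, hc, h⟩ := (theorem4_general (k := k) (by lia)).2
  refine ⟨c, hc, fun ℓ n m hℓ₂ hℓ hn hm ↦ (h ℓ n m hℓ₂ hℓ hn hm).imp_right fun hle ↦ hle.trans ?_⟩
  gcongr
  exact inv_natCast_le_rpow_neg n (by norm_num)
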